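/- Let $R$ be a valuation domain of cardinality $\aleph_1$ with quotient field $Q\neq R$, and let $A\subseteq J$ be $R$-submodules of $Q$. Definitions. A uniserial $R$-module is one whose submodules are totally ordered by inclusion. A uniserial module $U$ is of type $J/A$ if $J/A\cong D(a)/\mathrm{Ann}(a)$ for a non-zero $a\in U$, where $D(a)=\bigcup\{r^{-1}R : r \text{ divides } a \text{ in } U\}$ (this does not depend on $a$); $U$ is non-standard if it is not isomorphic to $J'/A'$ for any $R$-submodules $A'\subseteq J'$ of $Q$. For $S\subseteq\omega_1$ let $\tilde S$ be the class of $S$ under the relation: $S_1\sim S_2$ iff $S_1\cap C=S_2\cap C$ for some closed unbounded $C\subseteq\omega_1$; let $0=\tilde\emptyset$ and $1=\tilde\omega_1$. If $J=\bigcup_{\nu<\omega_1} r_\nu^{-1}R$ for non-zero $r_\nu\in Q$ with $r_\nu\in r_\mu R$ for all $\mu<\nu$, put $J_\delta=\bigcup_{\nu<\delta}r_\nu^{-1}R$; then $\Gamma_R(J/A)$ is the class of the set of limit ordinals $\delta<\omega_1$ such that $R/(A:J_\delta)$ is not complete in the linear topology in which the images of $r_\nu A\cap R$ $(\nu<\delta)$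 are a basis of neighbourhoods of $0$ (the class does not depend on the choice of the $r_\nu$). If $J$ has no such representation, $\Gamma_R(J/A)=0$. The principle $\diamondsuit_{\omega_1}(S)$ says that there are $T_\alpha\subseteq\alpha$ $(\alpha\in S)$ such that $\{\alpha\in S : X\cap\alpha=T_\alpha\}$ is stationary for every $X\subseteq\omega_1$. The weak diamond principle $\Phi_{\omega_1}(S)$ says that for all functions $P_\alpha:\mathcal P(\alpha)\to 2$ $(\alpha\in S)$ there is $\rho:S\to 2$ such that $\{\alpha\in S : P_\alpha(X\cap\alpha)=\rho(\alpha)\}$ is stationary for every $X\subseteq\omega_1$. Then: (i) For every $S\subseteq\omega_1$ with $\Gamma_R(J/A)=\tilde S$, $\diamondsuit_{\omega_1}(S)$ implies that there is a non-standard uniserial $R$-module of type $J/A$; indeed, already $\Phi_{\omega_1}(S)$ implies this. (ii) If $\Gamma_R(J/A)=1$, then CH implies that there is a non-standard uniserial $R$-module of type $J/A$. -/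

import Mathlib

open Cardinal Ordinal

namespace Uniserial

/-! ### Combinatorics of `ω₁` -/

/-- The first uncountable ordinal, as a well-ordered type (its elements are the countable
ordinals). -/
abbrev Omega1 : Type := (ω₁ : Ordinal.{0}).ToType

theorem cof_omega1_ne : Order.cof Omega1 ≠ ℵ₀ := by
  rw [Ordinal.cof_toType, Cardinal.cof_omega_one]
  exact Cardinal.aleph0_lt_aleph_one.ne'

theorem exists_lt_of_countable {s : Set Omega1} (hs : s.Countable) : ∃ a, ∀ b ∈ s, b < a := by
  refine not_isCofinal_iff.1 fun h => ?_
  have h1 : Order.cof Omega1 ≤ ℵ₀ :=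
    (Order.cof_le h).trans (Cardinal.le_aleph0_iff_set_countable.2 hs)
  rw [Ordinal.cof_toType, Cardinal.cof_omega_one] at h1
  exact h1.not_gt Cardinal.aleph0_lt_aleph_one

theorem countable_Iio (a : Omega1) : (Set.Iio a).Countable := by
  rw [← Cardinal.le_aleph0_iff_set_countable, ← Cardinal.lt_aleph_one_iff]
  have h := mk_Iio_lt a (by simp)
  simpa using h

/-- The set of ordinals that are closed under a function is a cub. -/
theorem isClub_closed (f : Omega1 → Omega1) : IsClub {δ : Omega1 | ∀ ν < δ, f ν < δ} := by
  constructor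
  · intro t ht _ _ x hx ν hν
    obtain ⟨y, hy, hνy⟩ := (lt_isLUB_iff hx).1 hν
    exact (ht hy ν hνy).trans_le (hx.1 hy)
  · intro a
    have key : ∀ b : Omega1, ∃ c, b < c ∧ ∀ ν < b, f ν < c := by
      intro b
      obtain ⟨c, hc⟩ := exists_lt_of_countable (((countable_Iio b).image f).insert b)
      exact ⟨c, hc b (Set.mem_insert _ _), fun ν hν =>
        hc _ (Set.mem_insert_of_mem _ ⟨ν, hν, rfl⟩)⟩
    choose h hlt hh using key
    let g : ℕ → Omega1 := fun n => h^[n] a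
    have hg : ∀ n, g (n + 1) = h (g n) := fun n => Function.iterate_succ_apply' h n a
    obtain ⟨b, hb⟩ := exists_lt_of_countable (Set.countable_range g)
    obtain ⟨m, hm, hmin⟩ := WellFounded.has_min (wellFounded_lt (α := Omega1))
      {b | ∀ n, g n < b} ⟨b, fun n => hb _ ⟨n, rfl⟩⟩
    refine ⟨m, fun ν hν => ?_, (hm 0).le⟩
    obtain ⟨n, hn⟩ : ∃ n, ν ≤ g n := by
      by_contra hcon
      push Not at hcon
      exact hmin ν hcon hν
    have h1 : ν < g (n + 1) := hg n ▸ hn.trans_lt (hlt _)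
    exact (hg (n + 1) ▸ hh _ ν h1 : f ν < g (n + 2)).trans (hm _)

/-- Two subsets of `ω₁` are equivalent if they agree on a cub. -/
def clubSetoid : Setoid (Set Omega1) where
  r S T := ∃ C : Set Omega1, IsClub C ∧ S ∩ C = T ∩ C
  iseqv :=
    { refl := fun _ => ⟨Set.univ, IsClub.univ, rfl⟩
      symm := fun ⟨C, hC, h⟩ => ⟨C, hC, h.symm⟩
      trans := by
        rintro S T W ⟨C, hC, h⟩ ⟨D, hD, h'⟩
        refine ⟨C ∩ D, hC.inter cof_omega1_ne hD, ?_⟩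
        rw [← Set.inter_assoc, h, Set.inter_right_comm, h', Set.inter_right_comm,
          Set.inter_assoc] }

/-- `D(ω₁)`: the subsets of `ω₁` modulo the relation of agreeing on a cub. -/
def ClubClass : Type := Quotient clubSetoid

/-- The class `S̃` of a subset `S` of `ω₁`. -/
def ClubClass.mk (S : Set Omega1) : ClubClass := Quotient.mk clubSetoid S

/-- `0`: the class of the sets that are disjoint from a cub. -/
instance : Zero ClubClass := ⟨ClubClass.mk ∅⟩

/-- `1`: the class of the sets that contain a cub. -/
instance : One ClubClass := ⟨ClubClass.mk Set.univ⟩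

/-- The diamond principle `◇_{ω₁}(S)`. -/
def Diamond (S : Set Omega1) : Prop :=
  ∃ T : Omega1 → Set Omega1, (∀ α ∈ S, T α ⊆ Set.Iio α) ∧
    ∀ X : Set Omega1, IsStationary {α | α ∈ S ∧ X ∩ Set.Iio α = T α}

/-- The weak diamond principle `Φ_{ω₁}(S)` of Devlin and Shelah: for every family of 2-colourings
`P α` of the subsets of `α` there is `ρ : S → 2` such that for every `X ⊆ ω₁` the set of `α ∈ S` with
`P α (X ∩ α) = ρ α` is stationary. (The values of `P` and `ρ` outside these domains are
irrelevant.) -/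
def WeakDiamond (S : Set Omega1) : Prop :=
  ∀ P : Omega1 → Set Omega1 → Bool, ∃ ρ : Omega1 → Bool,
    ∀ X : Set Omega1, IsStationary {α | α ∈ S ∧ P α (X ∩ Set.Iio α) = ρ α}

/-! ### Uniserial modules and types -/

/-- A module is uniserial if its submodules are totally ordered by inclusion. -/
def IsUniserial (R U : Type*) [CommRing R] [AddCommGroup U] [Module R U] : Prop :=
  ∀ N P : Submodule R U, N ≤ P ∨ P ≤ N

section Types

variable {R : Type*} [CommRing R] {Q : Type*} [Field Q] [Algebra R Q]

/-- The module `J/A`, for submodules `A ≤ J` of `Q`. -/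
abbrev Quo (J A : Submodule R Q) : Type _ := J ⧸ A.submoduleOf J

/-- `D(a) = ⋃ {r⁻¹ R : r divides a in U}`, for `a ≠ 0`, as a submodule of `Q` (over a valuation
domain the union is that of a chain, hence equal to this supremum). -/
def divSubmodule (R : Type*) [CommRing R] (Q : Type*) [Field Q] [Algebra R Q] {U : Type*} [AddCommGroup U] [Module R U]
    (a : U) : Submodule R Q :=
  ⨆ r : {r : R // ∃ u : U, r • u = a}, Submodule.span R {(algebraMap R Q r.1)⁻¹}

/-- `Ann(a) = {r ∈ R : r a = 0}`, as a submodule of `Q`. -/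
def annSubmodule (R : Type*) [CommRing R] (Q : Type*) [Field Q] [Algebra R Q] {U : Type*} [AddCommGroup U] [Module R U]
    (a : U) : Submodule R Q :=
  Submodule.map (Algebra.linearMap R Q) (Ideal.torsionOf R U a)

/-- `U` is of type `J/A`: `J/A ≅ D(a)/Ann(a)` for a non-zero element `a` of `U`. -/
def HasType (U : Type*) [AddCommGroup U] [Module R U] (J A : Submodule R Q) : Prop :=
  ∃ a : U, a ≠ 0 ∧ Nonempty (Quo J A ≃ₗ[R] Quo (divSubmodule R Q a) (annSubmodule R Q a))

/-- `U` is standard: it is isomorphic to `J/A` for some submodules `A ≤ J` of `Q`. -/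
def IsStandard (R : Type*) [CommRing R] (Q : Type*) [Field Q] [Algebra R Q]
    (U : Type*) [AddCommGroup U] [Module R U] : Prop :=
  ∃ J A : Submodule R Q, A ≤ J ∧ Nonempty (U ≃ₗ[R] Quo J A)

end Types

/-! ### The invariant `Γ` -/

section Complete

variable {R : Type*} [CommRing R]

/-- The uniform structure on the ring `R/K` of the linear topology for which the images of the
ideals `I i` (a chain of ideals) are a basis of neighbourhoods of `0`: its entourages are generated by
the sets `{(x, y) : x ≡ y modulo the image of I i}`. -/
@[reducible]
def linearUniformSpace (K : Ideal R) {ι : Type*} (I : ι → Ideal R) : UniformSpace (R ⧸ K) :=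
  ⨅ i, UniformSpace.comap (Ideal.Quotient.mk ((I i).map (Ideal.Quotient.mk K))) ⊥

/-- `R/K` is complete in the linear topology given by the ideals `I i`. -/
def IsLinearlyComplete (K : Ideal R) {ι : Type*} (I : ι → Ideal R) : Prop :=
  @CompleteSpace (R ⧸ K) (linearUniformSpace K I)

theorem linearUniformSpace_le (K : Ideal R) {ι κ : Type*} (I : ι → Ideal R) (I' : κ → Ideal R)
    (h : ∀ k, ∃ i, I i ≤ I' k) : linearUniformSpace K I ≤ linearUniformSpace K I' := by
  refine le_iInf fun k => ?_
  obtain ⟨i, hi⟩ := h k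
  refine (iInf_le _ i).trans ?_
  have hle : (I i).map (Ideal.Quotient.mk K) ≤ (I' k).map (Ideal.Quotient.mk K) :=
    Ideal.map_mono hi
  have hc : (Ideal.Quotient.mk ((I' k).map (Ideal.Quotient.mk K)) : _ → _) =
      Ideal.Quotient.factor hle ∘ Ideal.Quotient.mk ((I i).map (Ideal.Quotient.mk K)) := by
    ext x; simp
  rw [hc, UniformSpace.comap_comap]
  exact UniformSpace.comap_mono bot_le

end Complete

section Gamma

variable {R : Type*} [CommRing R] {Q : Type*} [Field Q] [Algebra R Q]

/-- `J = ⋃_{ν < ω₁} r_ν⁻¹ R` for non-zero `r_ν ∈ Q` such that `r_μ ∣ r_ν` (that is,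
`r_ν ∈ r_μ R`) for all `μ < ν`. -/
structure IsPresentation (J : Submodule R Q) (r : Omega1 → Q) : Prop where
  ne_zero : ∀ ν, r ν ≠ 0
  dvd : ∀ μ ν, μ < ν → ∃ c : R, r ν = c • r μ
  union : (J : Set Q) = ⋃ ν, (Submodule.span R {(r ν)⁻¹} : Set Q)

/-- `J_δ = ⋃_{ν < δ} r_ν⁻¹ R` (the union of a chain). -/
def partialUnion (R : Type*) [CommRing R] {Q : Type*} [Field Q] [Algebra R Q]
    (r : Omega1 → Q) (δ : Omega1) : Submodule R Q :=
  ⨆ ν : Set.Iio δ, Submodule.span R {(r ν)⁻¹}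

/-- The trace on `R` of the submodule `r_ν A` of `Q`. -/
def scaledIdeal (A : Submodule R Q) (q : Q) : Ideal R :=
  (A.map (LinearMap.mulLeft R q)).comap (Algebra.linearMap R Q)

/-- The set of limit ordinals `δ < ω₁` such that `R/(A : J_δ)`, with the linear topology given by
the submodules `r_ν A` (`ν < δ`), is not complete. -/
def gammaSet (A : Submodule R Q) (r : Omega1 → Q) : Set Omega1 :=
  {δ | Order.IsSuccLimit δ ∧
    ¬ IsLinearlyComplete (A.colon (partialUnion R r δ : Set Q))
      fun ν : Set.Iio δ => scaledIdeal A (r ν)}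

open Classical in
/-- `Γ_R(J/A)`: the class of `gammaSet A r` for any presentation `J = ⋃_{ν < ω₁} r_ν⁻¹ R`; it does
not depend on the presentation, see `Gamma_eq`. If there is none, it is `0`. -/
noncomputable def Gamma (J A : Submodule R Q) : ClubClass :=
  if h : ∃ r : Omega1 → Q, IsPresentation J r then ClubClass.mk (gammaSet A h.choose) else 0

theorem scaledIdeal_le (A : Submodule R Q) {p q : Q} (hp : p ≠ 0) (hq : q ≠ 0)
    (h : Submodule.span R {p⁻¹} ≤ Submodule.span R {q⁻¹}) :
    scaledIdeal A q ≤ scaledIdeal A p := by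
  obtain ⟨c, hc⟩ := Submodule.mem_span_singleton.1 (h (Submodule.mem_span_singleton_self p⁻¹))
  have hqp : q = c • p := by
    rw [Algebra.smul_def] at hc ⊢
    field_simp at hc
    exact hc.symm
  refine Submodule.comap_mono ?_
  rintro _ ⟨a, ha, rfl⟩
  refine ⟨c • a, A.smul_mem c ha, ?_⟩
  simp [hqp]

theorem partialUnion_le (r s : Omega1 → Q) (δ : Omega1)
    (h : ∀ ν < δ, ∃ μ < δ, Submodule.span R {(r ν)⁻¹} ≤ Submodule.span R {(s μ)⁻¹}) :
    partialUnion R r δ ≤ partialUnion R s δ := by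
  refine iSup_le fun ν => ?_
  obtain ⟨μ, hμ, hle⟩ := h ν.1 ν.2
  exact hle.trans (le_iSup (fun ν : Set.Iio δ => Submodule.span R {(s ν)⁻¹}) ⟨μ, hμ⟩)

theorem IsPresentation.exists_le {J : Submodule R Q} {r s : Omega1 → Q} (hr : IsPresentation J r)
    (hs : IsPresentation J s) (ν : Omega1) :
    ∃ μ, Submodule.span R {(r ν)⁻¹} ≤ Submodule.span R {(s μ)⁻¹} := by
  have h : (r ν)⁻¹ ∈ (J : Set Q) := by
    rw [hr.union]
    exact Set.mem_iUnion.2 ⟨ν, Submodule.mem_span_singleton_self _⟩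
  rw [hs.union] at h
  obtain ⟨μ, hμ⟩ := Set.mem_iUnion.1 h
  exact ⟨μ, (Submodule.span_singleton_le_iff_mem _ _).2 hμ⟩

theorem gammaSet_equiv {J : Submodule R Q} (A : Submodule R Q) {r s : Omega1 → Q}
    (hr : IsPresentation J r) (hs : IsPresentation J s) :
    ClubClass.mk (gammaSet A r) = ClubClass.mk (gammaSet A s) := by
  choose f hf using hr.exists_le hs
  choose g hg using hs.exists_le hr
  refine Quotient.sound ⟨{δ | ∀ ν < δ, f ν < δ} ∩ {δ | ∀ ν < δ, g ν < δ},
    (isClub_closed f).inter cof_omega1_ne (isClub_closed g), ?_⟩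
  ext δ
  simp only [Set.mem_inter_iff, and_congr_left_iff]
  rintro ⟨hfδ, hgδ⟩
  have hK : partialUnion R r δ = partialUnion R s δ :=
    le_antisymm (partialUnion_le r s δ fun ν hν => ⟨f ν, hfδ ν hν, hf ν⟩)
      (partialUnion_le s r δ fun ν hν => ⟨g ν, hgδ ν hν, hg ν⟩)
  have hU : linearUniformSpace (A.colon (partialUnion R s δ : Set Q))
        (fun ν : Set.Iio δ => scaledIdeal A (r ν)) =
      linearUniformSpace (A.colon (partialUnion R s δ : Set Q))
        (fun ν : Set.Iio δ => scaledIdeal A (s ν)) :=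
    le_antisymm
      (linearUniformSpace_le _ _ _ fun ν =>
        ⟨⟨g ν, hgδ ν ν.2⟩, scaledIdeal_le A (hs.ne_zero _) (hr.ne_zero _) (hg ν)⟩)
      (linearUniformSpace_le _ _ _ fun ν =>
        ⟨⟨f ν, hfδ ν ν.2⟩, scaledIdeal_le A (hr.ne_zero _) (hs.ne_zero _) (hf ν)⟩)
  have hC : IsLinearlyComplete (A.colon (partialUnion R r δ : Set Q))
        (fun ν : Set.Iio δ => scaledIdeal A (r ν)) ↔
      IsLinearlyComplete (A.colon (partialUnion R s δ : Set Q))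
        (fun ν : Set.Iio δ => scaledIdeal A (s ν)) := by
    rw [hK]
    exact iff_of_eq (congrArg (fun u => @CompleteSpace _ u) hU)
  exact and_congr_right fun _ => not_congr hC

/-- `Γ_R(J/A)` may be computed from any presentation of `J`. -/
theorem Gamma_eq {J A : Submodule R Q} {r : Omega1 → Q} (hr : IsPresentation J r) :
    Gamma J A = ClubClass.mk (gammaSet A r) := by
  have h : ∃ r : Omega1 → Q, IsPresentation J r := ⟨r, hr⟩
  rw [Gamma, dif_pos h]
  exact gammaSet_equiv A h.choose_spec hr

end Gamma

end Uniserial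

universe u v

namespace Uniserial

/-! ### Weak diamond -/

/-! Write `I ν = r ν A ∩ R`. Then `J/A` is the direct limit of the cyclic modules `R/I ν`, with
transition maps given by multiplication by `r μ / r ν`. Twisting these maps by units `e μ ν` that
are coherent modulo the `I ν` gives a module that is still uniserial of type `J/A` (once it is
non-zero). If it is standard, an isomorphism yields units `u ν` with `e μ ν * u μ ≡ u ν` from some
index on (`exists_units_of_isStandard`), so a coherent system with no such trivialization is enough.

Such a system is built by recursion. A system below `δ` always extends to `δ`, because `δ` has a
countable cofinal sequence. If `R/(A : J_δ)` is incomplete, a Cauchy family of units without limit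
provides two extensions such that no trivialization below `δ` survives both
(`exists_two_extensions`). Since there are at most `ℵ₁` units, trivializations are coded by subsets
of `ω₁`, and weak diamond chooses extensions that defeat all of them
(`WeakDiamond.exists_coherent`). Diamond implies weak diamond, and CH gives weak diamond on all of
`ω₁` by the Devlin–Shelah argument (`weakDiamond_univ`). -/

theorem mk_omega1 : Cardinal.mk Omega1 = Cardinal.aleph 1 := by
  rw [Cardinal.mk_toType, Ordinal.card_omega]

instance : Nonempty Omega1 := by
  rw [← Cardinal.mk_ne_zero_iff, mk_omega1]
  exact (Cardinal.aleph_pos 1).ne'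

theorem exists_isLUB_omega1 {s : Set Omega1} {b : Omega1} (hb : b ∈ upperBounds s) :
    ∃ a, IsLUB s a := by
  obtain ⟨m, hm, hmin⟩ := WellFounded.has_min (wellFounded_lt (α := Omega1)) (upperBounds s) ⟨b, hb⟩
  exact ⟨m, hm, fun c hc => not_lt.1 (hmin c hc)⟩

theorem Diamond.weakDiamond {S : Set Omega1} (h : Diamond S) : WeakDiamond S := by
  obtain ⟨T, -, hT⟩ := h
  refine fun P => ⟨fun α => P α (T α), fun X => (hT X).mono ?_⟩
  rintro α ⟨hα, h⟩
  exact ⟨hα, by rw [h]⟩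

theorem WeakDiamond.congr {S T : Set Omega1} (hS : WeakDiamond S)
    (h : ClubClass.mk S = ClubClass.mk T) : WeakDiamond T := by
  obtain ⟨C, hC, hST⟩ := Quotient.exact h
  intro P
  obtain ⟨ρ, hρ⟩ := hS P
  refine ⟨ρ, fun X D hD => ?_⟩
  obtain ⟨α, ⟨hαS, hα⟩, hαC, hαD⟩ := hρ X (hC.inter cof_omega1_ne hD)
  exact ⟨α, ⟨(hST.subset ⟨hαS, hαC⟩ : α ∈ T ∩ C).1, hα⟩, hαD⟩

theorem WeakDiamond.nonempty {S : Set Omega1} (hS : WeakDiamond S) : S.Nonempty := by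
  obtain ⟨ρ, hρ⟩ := hS fun _ _ => false
  obtain ⟨α, hα, -⟩ := (hρ ∅).nonempty
  exact ⟨α, hα⟩

open Classical in
/-- The least element of `C` above `α`, or `α` if there is none. -/
noncomputable def nextIn (C : Set Omega1) (α : Omega1) : Omega1 :=
  if h : {β | β ∈ C ∧ α < β}.Nonempty then
    WellFounded.min (wellFounded_lt (α := Omega1)) {β | β ∈ C ∧ α < β} h else α

theorem exists_gt_omega1 (a : Omega1) : ∃ b, a < b := by
  obtain ⟨b, hb⟩ := exists_lt_of_countable (Set.countable_singleton a)
  exact ⟨b, hb a rfl⟩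

theorem IsClub.exists_gt {C : Set Omega1} (hC : IsClub C) (α : Omega1) :
    {β | β ∈ C ∧ α < β}.Nonempty := by
  obtain ⟨b, hb⟩ := exists_gt_omega1 α
  obtain ⟨c, hc, hbc⟩ := hC.isCofinal b
  exact ⟨c, hc, hb.trans_le hbc⟩

theorem nextIn_spec {C : Set Omega1} (hC : IsClub C) (α : Omega1) :
    nextIn C α ∈ C ∧ α < nextIn C α := by
  rw [nextIn, dif_pos (IsClub.exists_gt hC α)]
  exact WellFounded.min_mem (wellFounded_lt (α := Omega1)) {β | β ∈ C ∧ α < β} _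

theorem nextIn_le {C : Set Omega1} {α β : Omega1} (hβ : β ∈ C) (h : α < β) :
    nextIn C α ≤ β := by
  rw [nextIn, dif_pos ⟨β, hβ, h⟩]
  exact WellFounded.min_le (wellFounded_lt (α := Omega1))
    (s := {β | β ∈ C ∧ α < β}) ⟨hβ, h⟩

/-- A pair consisting of a countable ordinal `β` and a sequence of subsets of `β` is coded by a
real. -/
theorem exists_code : ∃ c : Omega1 → (ℕ → Set Omega1) → ℕ → Bool, ∀ β β' Y Y',
    c β Y = c β' Y' → β = β' ∧ ∀ k, Y k ∩ Set.Iio β = Y' k ∩ Set.Iio β := by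
  have h1 : Nonempty (Omega1 × (ℕ → Set ℕ) ↪ (ℕ → Bool)) := by
    rw [← Cardinal.le_def]
    simp only [Cardinal.mk_prod, Cardinal.lift_id, mk_omega1, Cardinal.mk_pi, Cardinal.prod_const,
      Cardinal.mk_set, Cardinal.mk_nat, Cardinal.mk_bool,
      Cardinal.two_power_aleph0, Cardinal.continuum_power_aleph0]
    exact (mul_le_mul_left Cardinal.aleph_one_le_continuum _).trans
      Cardinal.continuum_mul_self.le
  obtain ⟨E⟩ := h1
  have h2 : ∀ β : Omega1, ∃ f : Omega1 → ℕ, Set.InjOn f (Set.Iio β) := fun β =>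
    Set.countable_iff_exists_injOn.1 (countable_Iio β)
  choose f hf using h2
  refine ⟨fun β Y => E (β, fun k => f β '' (Y k ∩ Set.Iio β)), fun β β' Y Y' h => ?_⟩
  have h := E.injective h
  simp only [Prod.mk.injEq] at h
  obtain ⟨rfl, h⟩ := h
  exact ⟨rfl, fun k => (hf β).image_eq_image_iff Set.inter_subset_right Set.inter_subset_right
    |>.1 (congrFun h k)⟩

/-! ### The Devlin–Shelah theorem -/

section DevlinShelah

variable {P : Omega1 → Set Omega1 → Bool}

/-- `hP` is what failure of weak diamond provides. Applying it to each bit of `g` and intersecting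
the countably many clubs predicts a whole real at once. Even indices hold the new sets, odd indices
preserve the old ones. -/
theorem exists_predicted
    (hP : ∀ ρ : Omega1 → Bool, ∃ X C, IsClub C ∧ ∀ α ∈ C, P α (X ∩ Set.Iio α) = ρ α)
    (Y₀ : ℕ → Set Omega1) {C₀ : Set Omega1} (hC₀ : IsClub C₀) (g : Omega1 → ℕ → Bool) :
    ∃ (Y : ℕ → Set Omega1) (C : Set Omega1), IsClub C ∧ C ⊆ C₀ ∧ (∀ k, Y (2 * k + 1) = Y₀ k) ∧
      ∀ α ∈ C, ∀ k, P α (Y (2 * k) ∩ Set.Iio α) = g α k := by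
  choose X C hC hX using fun k => hP fun α => g α k
  refine ⟨fun n => if n % 2 = 0 then X (n / 2) else Y₀ (n / 2), C₀ ∩ ⋂ k, C k,
    hC₀.inter cof_omega1_ne (IsClub.iInter_of_countable cof_omega1_ne hC),
    Set.inter_subset_left, fun k => ?_, fun α hα k => ?_⟩
  · have h1 : (2 * k + 1) % 2 ≠ 0 := by omega
    have h2 : (2 * k + 1) / 2 = k := by omega
    simp only [h1, if_false, h2]
  · have h1 : (2 * k) % 2 = 0 := by omega
    have h2 : (2 * k) / 2 = k := by omega
    simp only [h1, if_true, h2]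
    exact hX k α (Set.mem_iInter.1 hα.2 k)

/-- A sequence of iterated predictions that starts at `X`. -/
structure PredictionChain (P : Omega1 → Set Omega1 → Bool)
    (c : Omega1 → (ℕ → Set Omega1) → ℕ → Bool) (X : Set Omega1) where
  /-- The predicting sets. -/
  Y : ℕ → ℕ → Set Omega1
  /-- The clubs on which the predictions are right. -/
  C : ℕ → Set Omega1
  isClub : ∀ n, IsClub (C n)
  anti : Antitone C
  zero : ∀ k, Y 0 k = X
  succ : ∀ n k, Y (n + 1) (2 * k + 1) = Y n k
  predict : ∀ n, ∀ α ∈ C (n + 1), ∀ k,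
    P α (Y (n + 1) (2 * k) ∩ Set.Iio α) = c (nextIn (C n) α) (Y n) k

variable {c : Omega1 → (ℕ → Set Omega1) → ℕ → Bool}

theorem exists_predictionChain
    (hP : ∀ ρ : Omega1 → Bool, ∃ X C, IsClub C ∧ ∀ α ∈ C, P α (X ∩ Set.Iio α) = ρ α)
    (X : Set Omega1) : Nonempty (PredictionChain P c X) := by
  have key : ∀ p : {p : (ℕ → Set Omega1) × Set Omega1 // IsClub p.2},
      ∃ q : {p : (ℕ → Set Omega1) × Set Omega1 // IsClub p.2},
        q.1.2 ⊆ p.1.2 ∧ (∀ k, q.1.1 (2 * k + 1) = p.1.1 k) ∧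
        ∀ α ∈ q.1.2, ∀ k, P α (q.1.1 (2 * k) ∩ Set.Iio α) = c (nextIn p.1.2 α) p.1.1 k := by
    rintro ⟨⟨Y, C⟩, hC⟩
    obtain ⟨Y', C', hC', h⟩ := exists_predicted hP Y hC fun α => c (nextIn C α) Y
    exact ⟨⟨⟨Y', C'⟩, hC'⟩, h⟩
  choose F hF using key
  let st : ℕ → {p : (ℕ → Set Omega1) × Set Omega1 // IsClub p.2} := fun n =>
    F^[n] ⟨(fun _ => X, Set.univ), IsClub.univ⟩
  have hst : ∀ n, st (n + 1) = F (st n) := fun n => Function.iterate_succ_apply' F n _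
  exact ⟨⟨fun n => (st n).1.1, fun n => (st n).1.2, fun n => (st n).2,
    antitone_nat_of_succ_le fun n => hst n ▸ (hF (st n)).1, fun _ => rfl,
    fun n => hst n ▸ (hF (st n)).2.1, fun n => hst n ▸ (hF (st n)).2.2⟩⟩

namespace PredictionChain

variable {X X' : Set Omega1}

/-- The reindexing `k ↦ 2 * k + 1` does not depend on the chain, so one index serves both. -/
theorem exists_eq (p : PredictionChain P c X) (p' : PredictionChain P c X') {n m : ℕ} (h : n ≤ m)
    (k : ℕ) : ∃ k', p.Y m k' = p.Y n k ∧ p'.Y m k' = p'.Y n k := by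
  induction m, h using Nat.le_induction with
  | base => exact ⟨k, rfl, rfl⟩
  | succ m _ ih =>
    obtain ⟨k', h1, h2⟩ := ih
    exact ⟨2 * k' + 1, (p.succ m k').trans h1, (p'.succ m k').trans h2⟩

/-- The points of both systems of clubs below which two chains agree. -/
def agree (p : PredictionChain P c X) (p' : PredictionChain P c X') : Set Omega1 :=
  {α | (∀ n, α ∈ p.C n) ∧ (∀ n, α ∈ p'.C n) ∧
    ∀ n k, p.Y n k ∩ Set.Iio α = p'.Y n k ∩ Set.Iio α}

/-- Equal traces below `α` give equal predictions at `α`, hence equal codes: for every `n` the next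
point of `C n` after `α` is common to both chains, and their stage `n` sets agree up to it. The
supremum of these next points over `n` is the new point of agreement. -/
theorem exists_mem_agree_gt (hc : ∀ β β' Y Y', c β Y = c β' Y' →
      β = β' ∧ ∀ k, Y k ∩ Set.Iio β = Y' k ∩ Set.Iio β)
    (p : PredictionChain P c X) (p' : PredictionChain P c X') {α : Omega1} (hα : α ∈ agree p p') :
    ∃ β ∈ agree p p', α < β := by
  obtain ⟨hC, hC', hY⟩ := hα
  have key : ∀ n, nextIn (p.C n) α = nextIn (p'.C n) α ∧
      ∀ k, p.Y n k ∩ Set.Iio (nextIn (p.C n) α) = p'.Y n k ∩ Set.Iio (nextIn (p.C n) α) := by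
    intro n
    refine hc _ _ _ _ (funext fun k => ?_)
    rw [← p.predict n α (hC _) k, ← p'.predict n α (hC' _) k, hY]
  let a : ℕ → Omega1 := fun n => nextIn (p.C n) α
  have ha : Monotone a := fun n m h =>
    nextIn_le (p.anti h (nextIn_spec (p.isClub m) α).1) (nextIn_spec (p.isClub m) α).2
  obtain ⟨b, hb⟩ := exists_lt_of_countable (Set.countable_range a)
  obtain ⟨β, hβ⟩ := exists_isLUB_omega1 (s := Set.range a) (b := b) fun x hx => (hb x hx).le
  -- Every tail has the same supremum, and the tail from `n` on lies in `C n`; this puts `β` into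
  -- every club.
  have htail : ∀ n, IsLUB (a '' Set.Ici n) β := fun n =>
    ⟨fun x ⟨m, _, hx⟩ => hβ.1 ⟨m, hx⟩, fun y hy => hβ.2 fun x ⟨m, hx⟩ =>
      hx ▸ (ha (le_max_left m n)).trans (hy ⟨max m n, le_max_right m n, rfl⟩)⟩
  refine ⟨β, ⟨fun n => ?_, fun n => ?_, fun n k => ?_⟩,
    (nextIn_spec (p.isClub 0) α).2.trans_le (hβ.1 ⟨0, rfl⟩)⟩
  · refine (p.isClub n).isLUB_mem ?_ (Set.nonempty_Ici.image a) (htail n)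
    rintro _ ⟨m, hm, rfl⟩
    exact p.anti hm (nextIn_spec (p.isClub m) α).1
  · refine (p'.isClub n).isLUB_mem ?_ (Set.nonempty_Ici.image a) (htail n)
    rintro _ ⟨m, hm, rfl⟩
    have h := (nextIn_spec (p'.isClub m) α).1
    rw [← (key m).1] at h
    exact p'.anti hm h
  · ext x
    simp only [Set.mem_inter_iff, and_congr_left_iff]
    intro hx
    obtain ⟨_, ⟨m, rfl⟩, hm⟩ := (lt_isLUB_iff hβ).1 hx
    obtain ⟨k', h1, h2⟩ := exists_eq p p' (le_max_left n m) k
    have hx' : x ∈ Set.Iio (nextIn (p.C (max n m)) α) := hm.trans_le (ha (le_max_right n m))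
    have := Set.ext_iff.1 ((key (max n m)).2 k') x
    rw [h1, h2] at this
    exact ⟨fun h => (this.1 ⟨h, hx'⟩).1, fun h => (this.2 ⟨h, hx'⟩).1⟩

/-- The set of points of agreement is closed under suprema and has no largest element, so once
non-empty it is unbounded; stage `0` then compares `X` and `X'` everywhere. -/
theorem eq_of_agree_nonempty (hc : ∀ β β' Y Y', c β Y = c β' Y' →
      β = β' ∧ ∀ k, Y k ∩ Set.Iio β = Y' k ∩ Set.Iio β)
    (p : PredictionChain P c X) (p' : PredictionChain P c X') (h : (agree p p').Nonempty) :
    X = X' := by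
  by_cases hbd : ∃ b, b ∈ upperBounds (agree p p')
  · obtain ⟨b, hb⟩ := hbd
    obtain ⟨s, hs⟩ := exists_isLUB_omega1 hb
    have hsmem : s ∈ agree p p' := by
      refine ⟨fun n => (p.isClub n).isLUB_mem (fun x hx => hx.1 n) h hs,
        fun n => (p'.isClub n).isLUB_mem (fun x hx => hx.2.1 n) h hs, fun n k => ?_⟩
      ext x
      simp only [Set.mem_inter_iff, and_congr_left_iff]
      intro hx
      obtain ⟨y, hy, hxy⟩ := (lt_isLUB_iff hs).1 hx
      have := Set.ext_iff.1 (hy.2.2 n k) x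
      exact ⟨fun h => (this.1 ⟨h, hxy⟩).1, fun h => (this.2 ⟨h, hxy⟩).1⟩
    obtain ⟨β, hβ, hlt⟩ := exists_mem_agree_gt hc p p' hsmem
    exact absurd (hs.1 hβ) hlt.not_ge
  · ext x
    simp only [upperBounds, Set.mem_ofPred_eq, not_exists, not_forall, not_le] at hbd
    obtain ⟨y, hy, hxy⟩ := hbd x
    have := Set.ext_iff.1 (hy.2.2 0 0) x
    rw [p.zero, p'.zero] at this
    exact ⟨fun h => (this.1 ⟨h, hxy⟩).1, fun h => (this.2 ⟨h, hxy⟩).1⟩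

end PredictionChain

/-- The theorem of Devlin and Shelah: `2 ^ ℵ₀ < 2 ^ ℵ₁` implies the weak diamond principle. -/
theorem weakDiamond_univ (h : Cardinal.continuum.{0} < 2 ^ Cardinal.aleph.{0} 1) :
    WeakDiamond Set.univ := by
  by_contra hcon
  simp only [WeakDiamond, not_forall, not_exists, Set.mem_univ, true_and] at hcon
  obtain ⟨P, hP⟩ := hcon
  have hP' : ∀ ρ : Omega1 → Bool, ∃ X C, IsClub C ∧ ∀ α ∈ C, P α (X ∩ Set.Iio α) = ρ α := by
    intro ρ
    -- Colours are two-valued, so missing `!ρ` on a club means hitting `ρ` there.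
    obtain ⟨X, hX⟩ := hP fun α => !ρ α
    obtain ⟨C, hC, hd⟩ := not_isStationary_iff.1 hX
    refine ⟨X, C, hC, fun α hα => ?_⟩
    have := fun h => Set.disjoint_left.1 hd h hα
    simpa using this
  obtain ⟨c, hc⟩ := exists_code
  have ch : ∀ X, Nonempty (PredictionChain P c X) := exists_predictionChain hP'
  let p := fun X => (ch X).some
  have hD : ∀ X, ∃ m, ∀ n, m ∈ (p X).C n := fun X => by
    obtain ⟨m, hm⟩ := (IsClub.iInter_of_countable cof_omega1_ne (p X).isClub).nonempty
    exact ⟨m, Set.mem_iInter.1 hm⟩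
  choose m hm using hD
  -- One real records a common point of all the clubs and the traces of the whole chain on it. Equal
  -- reals give a point of agreement, so `d` injects the subsets of `ω₁` into the reals.
  let d : Set Omega1 → ℕ → Bool := fun X =>
    c (m X) fun j => (p X).Y j.unpair.1 j.unpair.2
  have hd : Function.Injective d := by
    intro X X' hXX'
    obtain ⟨h1, h2⟩ := hc _ _ _ _ hXX'
    refine (p X).eq_of_agree_nonempty hc (p X') ⟨m X, hm X, fun n => h1 ▸ hm X' n, fun n k => ?_⟩
    have h3 := h2 (Nat.pair n k)
    simpa using h3
  have hle := Cardinal.mk_le_of_injective hd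
  rw [Cardinal.mk_set, mk_omega1] at hle
  refine h.not_ge (hle.trans ?_)
  simp
end DevlinShelah

/-! ### Coherent systems modulo a chain of subgroups -/

section Coherent

variable {G : Type*} [CommGroup G] {N : Omega1 → Subgroup G}

theorem quotient_eq_of_le {K L : Subgroup G} (h : K ≤ L) {a b : G}
    (hab : (a : G ⧸ K) = b) : (a : G ⧸ L) = b :=
  QuotientGroup.eq.2 (h (QuotientGroup.eq.1 hab))

/-- The elements `e μ ν` (`ν ≤ μ < δ`) form a coherent system modulo the subgroups `N ν`. -/
structure CoherentBelow (N : Omega1 → Subgroup G) (e : Omega1 → Omega1 → G) (δ : Omega1) :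
    Prop where
  refl : ∀ ν < δ, e ν ν = 1
  comp : ∀ ν μ τ, ν ≤ μ → μ ≤ τ → τ < δ → ((e μ ν * e τ μ : G) : G ⧸ N ν) = (e τ ν : G)

/-- The family `w` is compatible, below `δ`, with the system `e`. -/
def CompatBelow (N : Omega1 → Subgroup G) (e : Omega1 → Omega1 → G) (δ : Omega1) (w : Omega1 → G) :
    Prop :=
  ∀ ν μ, ν ≤ μ → μ < δ → ((e μ ν * w μ : G) : G ⧸ N ν) = (w ν : G)

theorem exists_monotone_cofinal {δ : Omega1} (h : (Set.Iio δ).Nonempty) :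
    ∃ s : ℕ → Omega1, Monotone s ∧ (∀ n, s n < δ) ∧ ∀ ν < δ, ∃ n, ν ≤ s n := by
  have : Nonempty (Set.Iio δ) := h.to_subtype
  have : Countable (Set.Iio δ) := (countable_Iio δ).to_subtype
  obtain ⟨a, ha⟩ := exists_surjective_nat (Set.Iio δ)
  refine ⟨fun n => (partialSups a n : Set.Iio δ), fun n m hnm => (partialSups a).monotone hnm,
    fun n => (partialSups a n).2, fun ν hν => ?_⟩
  obtain ⟨n, hn⟩ := ha ⟨ν, hν⟩
  refine ⟨n, ?_⟩
  have := le_partialSups a n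
  rw [hn] at this
  exact this

/-- Along a cofinal `ω`-sequence the equations are solved exactly, one inverse at a time. The value
at any `ν` is transported down from a later term of the sequence; coherence makes it independent of
that term modulo `N ν`. -/
theorem CoherentBelow.exists_compat (hN : Antitone N) {e : Omega1 → Omega1 → G} {δ : Omega1}
    (he : CoherentBelow N e δ) : ∃ w, CompatBelow N e δ w := by
  rcases (Set.Iio δ).eq_empty_or_nonempty with h | h
  · exact ⟨1, fun ν μ _ hμ => absurd hμ (Set.eq_empty_iff_forall_notMem.1 h μ)⟩
  obtain ⟨s, hs, hsδ, hcof⟩ := exists_monotone_cofinal h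
  obtain ⟨W, hW⟩ : ∃ W : ℕ → G, ∀ n, W (n + 1) = (e (s (n + 1)) (s n))⁻¹ * W n :=
    ⟨Nat.rec 1 fun n x => (e (s (n + 1)) (s n))⁻¹ * x, fun n => rfl⟩
  have h1 : ∀ n m, n ≤ m → ((e (s m) (s n) * W m : G) : G ⧸ N (s n)) = (W n : G) := by
    intro n m hnm
    induction m, hnm using Nat.le_induction with
    | base => rw [he.refl _ (hsδ n), one_mul]
    | succ m hnm ih =>
      have h2 := he.comp _ _ _ (hs hnm) (hs m.le_succ) (hsδ (m + 1))
      rw [← ih, hW, QuotientGroup.mk_mul, ← h2]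
      simp only [QuotientGroup.mk_mul, QuotientGroup.mk_inv]
      simp [mul_assoc]
  choose! n hn using hcof
  have h3 : ∀ ν m, ν ≤ s m →
      ((e (s m) ν * W m : G) : G ⧸ N ν) = (e (s (n ν)) ν * W (n ν) : G) := by
    have aux : ∀ ν m k, m ≤ k → ν ≤ s m →
        ((e (s k) ν * W k : G) : G ⧸ N ν) = (e (s m) ν * W m : G) := by
      intro ν m k hmk hν
      have h4 := quotient_eq_of_le (hN hν) (h1 m k hmk)
      rw [QuotientGroup.mk_mul, ← he.comp _ _ _ hν (hs hmk) (hsδ k),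
        QuotientGroup.mk_mul _ (e (s m) ν) (W m), ← h4]
      simp only [QuotientGroup.mk_mul, mul_assoc]
    intro ν m hν
    have hν' := hn ν (hν.trans_lt (hsδ m))
    rcases le_total m (n ν) with h | h
    · exact (aux ν m _ h hν).symm
    · exact aux ν _ m h hν'
  refine ⟨fun ν => e (s (n ν)) ν * W (n ν), fun ν μ hνμ hμ => ?_⟩
  have hμ' := hn μ hμ
  rw [← h3 ν (n μ) (hνμ.trans hμ'), QuotientGroup.mk_mul _ (e (s (n μ)) ν),
    ← he.comp ν μ _ hνμ hμ' (hsδ _)]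
  simp only [QuotientGroup.mk_mul, mul_assoc]

/-- The family `t` is Cauchy below `δ` and has no limit. -/
def IsGapBelow (N : Omega1 → Subgroup G) (δ : Omega1) (t : Omega1 → G) : Prop :=
  (∀ ν μ, ν ≤ μ → μ < δ → (t μ : G ⧸ N ν) = t ν) ∧ ¬ ∃ x : G, ∀ ν < δ, (x : G ⧸ N ν) = t ν

/-- The value at `κ` forces the values below it. This is needed because an isomorphism is only
exploited from an index where the generator is non-zero. -/
theorem exists_compat_of_tail (hN : Antitone N) {e : Omega1 → Omega1 → G}
    (he : ∀ δ, CoherentBelow N e δ) (κ : Omega1) {u : Omega1 → G}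
    (hu : ∀ ν μ, κ ≤ ν → ν ≤ μ → ((e μ ν * u μ : G) : G ⧸ N ν) = (u ν : G)) :
    ∃ u : Omega1 → G, ∀ δ, CompatBelow N e δ u := by
  classical
  have hc : ∀ ν μ τ, ν ≤ μ → μ ≤ τ → ((e μ ν * e τ μ : G) : G ⧸ N ν) = (e τ ν : G) :=
    fun ν μ τ h h' => by
      obtain ⟨δ, hδ⟩ := exists_gt_omega1 τ
      exact (he δ).comp ν μ τ h h' hδ
  refine ⟨fun ν => if κ ≤ ν then u ν else e κ ν * u κ, fun δ ν μ hνμ _ => ?_⟩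
  by_cases h1 : κ ≤ ν
  · simpa only [h1, h1.trans hνμ, if_true] using hu ν μ h1 hνμ
  have h1' := (not_le.1 h1).le
  by_cases h2 : κ ≤ μ
  · simp only [h1, h2, if_true, if_false]
    rw [QuotientGroup.mk_mul, ← hc ν κ μ h1' h2, QuotientGroup.mk_mul _ (e κ ν) (u κ),
      ← quotient_eq_of_le (hN h1') (hu κ μ le_rfl h2)]
    simp only [QuotientGroup.mk_mul, mul_assoc]
  · simp only [h1, h2, if_false]
    rw [QuotientGroup.mk_mul _ (e κ ν) (u κ), ← hc ν μ κ hνμ (not_le.1 h2).le]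
    simp only [QuotientGroup.mk_mul, mul_assoc]

/-- The two families are `w` and `w * t` with `t` a gap: if they differed by a constant `x`, then
`x` would be a limit of `t`. The value `1` at `δ` makes the new diagonal entry trivial. -/
theorem exists_two_extensions (hN : Antitone N) (S : Set Omega1)
    (hS : ∀ δ ∈ S, ∃ t, IsGapBelow N δ t) (δ : Omega1) (e : Omega1 → Omega1 → G) :
    ∃ w : Bool → Omega1 → G, (∀ b, w b δ = 1) ∧ (CoherentBelow N e δ →
      (∀ b, CompatBelow N e δ (w b)) ∧
      (δ ∈ S → ¬ ∃ x : G, ∀ ν < δ, ((w true ν : G) : G ⧸ N ν) = (w false ν * x : G))) := by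
  classical
  suffices H : ∃ w : Bool → Omega1 → G, (CoherentBelow N e δ →
      (∀ b, CompatBelow N e δ (w b)) ∧
      (δ ∈ S → ¬ ∃ x : G, ∀ ν < δ, ((w true ν : G) : G ⧸ N ν) = (w false ν * x : G))) by
    obtain ⟨w, hw⟩ := H
    refine ⟨fun b => Function.update (w b) δ 1, fun b => Function.update_self .., fun he => ?_⟩
    have hne : ∀ b, ∀ ν < δ, Function.update (w b) δ 1 ν = w b ν := fun b ν hν =>
      Function.update_of_ne hν.ne ..
    refine ⟨fun b ν μ hνμ hμ => ?_, fun hδ ⟨x, hx⟩ => (hw he).2 hδ ⟨x, fun ν hν => ?_⟩⟩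
    · simp only [hne b _ hμ, hne b _ (hνμ.trans_lt hμ)]
      exact (hw he).1 b ν μ hνμ hμ
    · have := hx ν hν
      simpa only [hne _ _ hν] using this
  by_cases he : CoherentBelow N e δ
  swap
  · exact ⟨1, fun h => absurd h he⟩
  obtain ⟨w, hw⟩ := he.exists_compat hN
  by_cases hδ : δ ∈ S
  swap
  · exact ⟨fun _ => w, fun _ => ⟨fun _ => hw, fun h => absurd h hδ⟩⟩
  obtain ⟨t, ht, hlim⟩ := hS δ hδ
  refine ⟨fun b => if b then w * t else w, fun _ => ⟨?_, fun _ ⟨x, hx⟩ => hlim ⟨x, fun ν hν => ?_⟩⟩⟩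
  · rintro (_ | _)
    · simpa using hw
    · intro ν μ hνμ hμ
      have h1 := hw ν μ hνμ hμ
      simp only [if_true, Pi.mul_apply]
      rw [QuotientGroup.mk_mul _ (w ν), ← ht ν μ hνμ hμ, ← h1]
      simp only [QuotientGroup.mk_mul, mul_assoc]
  · have := hx ν hν
    simp only [if_true, Pi.mul_apply, Bool.false_eq_true, if_false, QuotientGroup.mk_mul] at this
    exact (mul_left_cancel this).symm

/-! ### Recursive construction against weak diamond -/

variable (step : Omega1 → (Omega1 → Omega1 → G) → Bool → Omega1 → G)

open Classical in
/-- The system below `δ`, extended by `1`. -/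
noncomputable def truncate (e : Omega1 → Omega1 → G) (δ : Omega1) : Omega1 → Omega1 → G :=
  fun γ => if γ < δ then e γ else 1

open Classical in
/-- The system obtained by iterating `step` along the choices `ρ`. -/
noncomputable def iterSystem (ρ : Omega1 → Bool) : Omega1 → Omega1 → G :=
  WellFounded.fix (wellFounded_lt (α := Omega1)) fun δ prev =>
    step δ (fun γ => if h : γ < δ then prev γ h else 1) (ρ δ)

theorem iterSystem_eq (ρ : Omega1 → Bool) (δ : Omega1) :
    iterSystem step ρ δ = step δ (truncate (iterSystem step ρ) δ) (ρ δ) := by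
  rw [iterSystem, WellFounded.fix_eq]
  congr 1

theorem truncate_congr {e e' : Omega1 → Omega1 → G} {δ : Omega1} (h : ∀ γ < δ, e γ = e' γ) :
    truncate e δ = truncate e' δ := by
  funext γ
  by_cases hγ : γ < δ
  · simp [truncate, hγ, h γ hγ]
  · simp [truncate, hγ]

/-- This lets a guess at `δ`, which sees the choices only below `δ`, reconstruct the system built so
far. -/
theorem iterSystem_congr {ρ ρ' : Omega1 → Bool} {δ : Omega1} (h : ∀ γ < δ, ρ γ = ρ' γ) :
    ∀ γ < δ, iterSystem step ρ γ = iterSystem step ρ' γ := by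
  intro γ
  induction γ using WellFoundedLT.induction with
  | ind γ ih =>
    intro hγ
    rw [iterSystem_eq, iterSystem_eq step ρ', h γ hγ,
      truncate_congr fun τ hτ => ih τ hτ (hτ.trans hγ)]

theorem CoherentBelow.congr {e e' : Omega1 → Omega1 → G} {δ : Omega1} (h : ∀ γ < δ, e γ = e' γ)
    (he : CoherentBelow N e δ) : CoherentBelow N e' δ :=
  ⟨fun ν hν => by rw [← h ν hν, he.refl ν hν], fun ν μ τ hνμ hμτ hτ => by
    rw [← h μ (hμτ.trans_lt hτ), ← h τ hτ, he.comp ν μ τ hνμ hμτ hτ]⟩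

theorem eq_truncate (e : Omega1 → Omega1 → G) {δ : Omega1} : ∀ γ < δ, e γ = truncate e δ γ :=
  fun γ hγ => by simp [truncate, hγ]

theorem CompatBelow.congr {e e' : Omega1 → Omega1 → G} {δ : Omega1} (h : ∀ γ < δ, e γ = e' γ)
    {w : Omega1 → G} (hw : CompatBelow N e δ w) : CompatBelow N e' δ w := fun ν μ hνμ hμ => by
  rw [← h μ hμ, hw ν μ hνμ hμ]

theorem coherentBelow_iterSystem
    (hstep : ∀ δ e, (∀ b, step δ e b δ = 1) ∧
      (CoherentBelow N e δ → ∀ b, CompatBelow N e δ (step δ e b)))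
    (ρ : Omega1 → Bool) (δ : Omega1) : CoherentBelow N (iterSystem step ρ) δ := by
  have hone : ∀ δ, iterSystem step ρ δ δ = 1 := fun δ => by
    rw [iterSystem_eq]
    exact (hstep δ _).1 _
  induction δ using WellFoundedLT.induction with
  | ind δ ih =>
    refine ⟨fun ν _ => hone ν, fun ν μ τ hνμ hμτ hτ => ?_⟩
    rcases hμτ.eq_or_lt with rfl | hlt
    · rw [hone, mul_one]
    · have h1 := (hstep τ _).2 ((ih τ hτ).congr (eq_truncate _)) (ρ τ)
      rw [← iterSystem_eq step] at h1
      exact h1.congr (fun γ hγ => (eq_truncate _ γ hγ).symm) ν μ hνμ hlt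

/-- Pairs of functions on `ω₁` are coded by subsets of `ω₁`, and the code of the restriction to
almost every `δ` is the trace on `δ` of the code. -/
theorem exists_decode (hG : Cardinal.mk G ≤ Cardinal.aleph 1) :
    ∃ (f : Set Omega1 → Omega1 → G) (g : Set Omega1 → Omega1 → Bool),
      ∀ (u : Omega1 → G) (ρ : Omega1 → Bool), ∃ (X C : Set Omega1), IsClub C ∧
        ∀ δ ∈ C, ∀ ν < δ, f (X ∩ Set.Iio δ) ν = u ν ∧ g (X ∩ Set.Iio δ) ν = ρ ν := by
  classical
  have h1 : Nonempty (G ↪ Omega1) := by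
    rw [← Cardinal.lift_mk_le', mk_omega1]
    simpa using hG
  have h2 : Nonempty ((Omega1 × Omega1) ⊕ Omega1 ↪ Omega1) := by
    rw [← Cardinal.le_def]
    simp
  obtain ⟨i⟩ := h1
  obtain ⟨θ⟩ := h2
  have hi : ∀ {ν μ : Omega1} {a b : G}, θ (.inl (ν, i a)) = θ (.inl (μ, i b)) → ν = μ ∧ a = b := by
    intro ν μ a b h
    have := θ.injective h
    simp only [Sum.inl.injEq, Prod.mk.injEq] at this
    exact ⟨this.1, i.injective this.2⟩
  refine ⟨fun Y ν => if h : ∃ a, θ (.inl (ν, i a)) ∈ Y then h.choose else 1,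
    fun Y ν => decide (θ (.inr ν) ∈ Y), fun u ρ => ?_⟩
  -- The graph of `u` and the support of `ρ`, placed in disjoint parts of `ω₁` by `θ`.
  let X : Set Omega1 := {x | (∃ ν, x = θ (.inl (ν, i (u ν)))) ∨ ∃ ν, x = θ (.inr ν) ∧ ρ ν = true}
  refine ⟨X, {δ | ∀ ν < δ, θ (.inl (ν, i (u ν))) < δ} ∩ {δ | ∀ ν < δ, θ (.inr ν) < δ},
    (isClub_closed _).inter cof_omega1_ne (isClub_closed _), ?_⟩
  rintro δ ⟨h1, h2⟩ ν hν
  constructor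
  · have hex : ∃ a, θ (.inl (ν, i a)) ∈ X ∩ Set.Iio δ := ⟨u ν, Or.inl ⟨ν, rfl⟩, h1 ν hν⟩
    simp only [dif_pos hex]
    obtain ⟨⟨μ, hμ⟩ | ⟨μ, hμ, -⟩, -⟩ := hex.choose_spec
    · obtain ⟨rfl, h⟩ := hi hμ
      exact h
    · simpa using θ.injective hμ
  · have : θ (.inr ν) ∈ X ∩ Set.Iio δ ↔ ρ ν = true := by
      constructor
      · rintro ⟨⟨μ, hμ⟩ | ⟨μ, hμ, h⟩, -⟩
        · simpa using θ.injective hμ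
        · have := θ.injective hμ
          simp only [Sum.inr.injEq] at this
          rwa [this]
      · exact fun h => ⟨Or.inr ⟨ν, rfl, h⟩, h2 ν hν⟩
    by_cases h : ρ ν = true <;> simp [this, h]

/-- Under weak diamond for a set of places where there are gaps, there is a coherent system that is
not trivial. -/
theorem WeakDiamond.exists_coherent {S : Set Omega1} (hW : WeakDiamond S)
    (hG : Cardinal.mk G ≤ Cardinal.aleph 1) (hN : Antitone N)
    (hS : ∀ δ ∈ S, ∃ t, IsGapBelow N δ t) :
    ∃ e : Omega1 → Omega1 → G, (∀ δ, CoherentBelow N e δ) ∧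
      ¬ ∃ u : Omega1 → G, ∀ δ, CompatBelow N e δ u := by
  classical
  choose step hone hstep using exists_two_extensions hN S hS
  have hcoh : ∀ ρ δ, CoherentBelow N (iterSystem step ρ) δ := coherentBelow_iterSystem step
    fun δ e => ⟨hone δ e, fun he => (hstep δ e he).1⟩
  obtain ⟨f, g, hfg⟩ := exists_decode hG
  let opt : Omega1 → (Omega1 → Bool) → Bool → Omega1 → G := fun α ρ =>
    step α (truncate (iterSystem step ρ) α)
  -- The colour tells whether the decoded family is incompatible with the option `true`. Using the
  -- colour itself as the choice blocks the family: either `true` is impossible for it, or it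
  -- extends along `true` and so cannot extend along `false`.
  obtain ⟨ρ, hρ⟩ := hW fun α Y =>
    decide (¬ ∃ x : G, ∀ ν < α, (f Y ν : G ⧸ N ν) = (opt α (g Y) true ν * x : G))
  refine ⟨iterSystem step ρ, hcoh ρ, fun ⟨u, hu⟩ => ?_⟩
  obtain ⟨X, C, hC, hX⟩ := hfg u ρ
  obtain ⟨α, ⟨hαS, hα⟩, hαC⟩ := hρ X hC
  obtain ⟨β, hαβ⟩ := exists_gt_omega1 α
  have hopt : opt α (g (X ∩ Set.Iio α)) = opt α ρ := by
    simp only [opt]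
    rw [truncate_congr (iterSystem_congr step fun γ hγ => (hX α hαC γ hγ).2)]
  have hα' : (¬ ∃ x : G, ∀ ν < α, (u ν : G ⧸ N ν) = (opt α ρ true ν * x : G)) ↔ ρ α = true := by
    rw [← hα, decide_eq_true_iff, hopt]
    refine not_congr (exists_congr fun x => forall₂_congr fun ν hν => ?_)
    rw [(hX α hαC ν hν).1]
  have hlim : ∀ ν < α, (u ν : G ⧸ N ν) = (opt α ρ (ρ α) ν * u α : G) := fun ν hν => by
    have := hu β ν α hν.le hαβ
    rw [iterSystem_eq] at this
    exact this.symm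
  by_cases h : ρ α = true
  · rw [h] at hlim
    exact hα'.2 h ⟨u α, hlim⟩
  · obtain ⟨x, hx⟩ := not_not.1 (mt hα'.1 h)
    rw [Bool.not_eq_true] at h
    rw [h] at hlim
    refine (hstep α _ ((hcoh ρ α).congr (eq_truncate _))).2 hαS ⟨u α * x⁻¹, fun ν hν => ?_⟩
    have h1 := (hx ν hν).symm.trans (hlim ν hν)
    rw [← mul_assoc, QuotientGroup.mk_mul _ _ x⁻¹, ← h1]
    simp [opt]

end Coherent

/-! ### Completeness and units -/

section Complete

variable {R : Type*} [CommRing R]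

/-- A Cauchy filter contains a coset modulo each `I i`; representatives form a Cauchy family, and a
limit of that family is a limit of the filter. -/
theorem exists_cauchy_of_not_isLinearlyComplete {K : Ideal R} {ι : Type*} [LinearOrder ι]
    {I : ι → Ideal R} (hI : Antitone I) (hK : ∀ i, K ≤ I i) (h : ¬ IsLinearlyComplete K I) :
    ∃ t : ι → R, (∀ i j, i ≤ j → t j - t i ∈ I i) ∧ ¬ ∃ x, ∀ i, x - t i ∈ I i := by
  by_contra H
  push Not at H
  refine h ?_
  let q : ∀ i, R ⧸ K → (R ⧸ K) ⧸ (I i).map (Ideal.Quotient.mk K) := fun i =>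
    Ideal.Quotient.mk ((I i).map (Ideal.Quotient.mk K))
  have hq : ∀ i x y, q i (Ideal.Quotient.mk K x) = q i (Ideal.Quotient.mk K y) ↔ x - y ∈ I i := by
    intro i x y
    rw [Ideal.Quotient.eq, ← map_sub, ← Ideal.mem_comap,
      Ideal.comap_map_of_surjective _ Ideal.Quotient.mk_surjective, ← RingHom.ker_eq_comap_bot,
      Ideal.mk_ker, sup_eq_left.2 (hK i)]
  unfold IsLinearlyComplete
  let T := linearUniformSpace K I
  have hT : uniformity (R ⧸ K) =
      ⨅ i, Filter.comap (Prod.map (q i) (q i)) (Filter.principal SetRel.id) := by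
    rw [show T = ⨅ i, UniformSpace.comap (q i) ⊥ from rfl, iInf_uniformity]
    rfl
  refine ⟨fun {f} hf => ?_⟩
  have := hf.1
  have h1 : ∀ i, ∃ y, {x | q i x = q i (Ideal.Quotient.mk K y)} ∈ f := by
    intro i
    have h2 : Filter.comap (Prod.map (q i) (q i)) (Filter.principal SetRel.id) ≥ f ×ˢ f :=
      hf.2.trans (hT.le.trans (iInf_le _ i))
    rw [Filter.comap_principal, ge_iff_le, Filter.le_principal_iff, Filter.mem_prod_same_iff] at h2
    obtain ⟨s, hs, hsub⟩ := h2
    obtain ⟨y, hy⟩ := Filter.nonempty_of_mem hs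
    obtain ⟨y, rfl⟩ := Ideal.Quotient.mk_surjective y
    exact ⟨y, Filter.mem_of_superset hs fun x hx => hsub (Set.mk_mem_prod hx hy)⟩
  choose t ht using h1
  obtain ⟨x, hx⟩ := H t fun i j hij => by
    obtain ⟨y, hyi, hyj⟩ := Filter.nonempty_of_mem (Filter.inter_mem (ht i) (ht j))
    obtain ⟨y, rfl⟩ := Ideal.Quotient.mk_surjective y
    have h3 := (hq i _ _).1 hyi
    have h4 := hI hij ((hq j _ _).1 hyj)
    simpa using sub_mem h3 h4
  refine ⟨Ideal.Quotient.mk K x, ?_⟩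
  rw [nhds_eq_comap_uniformity, hT, Filter.comap_iInf]
  refine le_iInf fun i => ?_
  rw [Filter.comap_principal, Filter.comap_principal, Filter.le_principal_iff]
  filter_upwards [ht i] with y hy
  exact ((hq i _ _).2 (hx i)).trans hy.symm

/-- The units of `R` that are congruent to `1` modulo `I`. -/
def unitsOneMod (I : Ideal R) : Subgroup Rˣ :=
  (Units.map (Ideal.Quotient.mk I : R →* R ⧸ I)).ker

theorem unitsOneMod_eq_iff {I : Ideal R} {u v : Rˣ} :
    (u : Rˣ ⧸ unitsOneMod I) = v ↔ (u : R) - v ∈ I := by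
  rw [QuotientGroup.eq, unitsOneMod, MonoidHom.mem_ker, map_mul, map_inv, inv_mul_eq_one,
    Units.ext_iff, ← Ideal.Quotient.eq]
  rfl

theorem unitsOneMod_mono {I I' : Ideal R} (h : I ≤ I') : unitsOneMod I ≤ unitsOneMod I' := by
  intro u hu
  have h1 : ((1 : Rˣ) : Rˣ ⧸ unitsOneMod I) = u := by
    rw [QuotientGroup.eq]
    simpa using hu
  have h2 := unitsOneMod_eq_iff.2 (h (unitsOneMod_eq_iff.1 h1))
  rw [QuotientGroup.eq] at h2
  simpa using h2

/-- In a local ring `t κ` or `1 - t κ` is a unit, and replacing `t` by `1 - t` affects neither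
hypothesis. As `I κ` lies in the maximal ideal, all terms from `κ` on are then units; earlier terms
are replaced by the one at `κ`. -/
theorem exists_gap_units [IsLocalRing R] {I : Omega1 → Ideal R} (hI : Antitone I) {δ : Omega1}
    {t : Omega1 → R} (ht : ∀ ν μ, ν ≤ μ → μ < δ → t μ - t ν ∈ I ν)
    (hlim : ¬ ∃ x, ∀ ν < δ, x - t ν ∈ I ν) :
    ∃ t, IsGapBelow (fun ν => unitsOneMod (I ν)) δ t := by
  classical
  obtain ⟨κ, hκδ, hκ⟩ : ∃ κ < δ, I κ ≠ ⊤ := by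
    by_contra! H
    exact hlim ⟨0, fun ν hν => by simp [H ν hν]⟩
  wlog hu : IsUnit (t κ) generalizing t
  · refine this (t := fun ν => 1 - t ν) (fun ν μ h h' => ?_) (fun ⟨x, hx⟩ => hlim ⟨1 - x,
      fun ν hν => ?_⟩) ((IsLocalRing.isUnit_or_isUnit_one_sub_self _).resolve_left hu)
    · simpa using neg_mem (ht ν μ h h')
    · have := neg_mem (hx ν hν)
      rwa [show -(x - (1 - t ν)) = 1 - x - t ν by ring] at this
  have hunit : ∀ ν, κ ≤ ν → ν < δ → IsUnit (t ν) := fun ν h h' => by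
    have h1 := IsLocalRing.le_maximalIdeal hκ (ht κ ν h h')
    by_contra hν
    have h2 := sub_mem ((IsLocalRing.mem_maximalIdeal _).2 hν) h1
    rw [sub_sub_cancel] at h2
    exact (IsLocalRing.mem_maximalIdeal _).1 h2 hu
  have hunit' : ∀ ν < δ, IsUnit (t (max ν κ)) := fun ν h =>
    hunit _ (le_max_right _ _) (max_lt h hκδ)
  choose! u hu using hunit'
  refine ⟨u, fun ν μ h h' => ?_, fun ⟨x, hx⟩ => hlim ⟨x, fun ν hν => ?_⟩⟩
  · rw [unitsOneMod_eq_iff, hu ν (h.trans_lt h'), hu μ h']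
    exact hI (le_max_left ν κ) (ht _ _ (max_le_max_right κ h) (max_lt h' hκδ))
  · have h1 := unitsOneMod_eq_iff.1 (hx ν hν)
    rw [hu ν hν] at h1
    have h2 := ht ν _ (le_max_left ν κ) (max_lt hν hκδ)
    simpa using add_mem h1 h2

end Complete

/-! ### Direct limits of cyclic modules -/

section Limit

/-- `h_mem` makes multiplication by `h ν μ` a well-defined injection of `R ⧸ I ν` into `R ⧸ I μ`; `a
ν` is the image of `1`. -/
theorem exists_limit {R : Type u} [CommRing R] {I : Omega1 → Ideal R} {h : Omega1 → Omega1 → R}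
    (h_self : ∀ ν, h ν ν - 1 ∈ I ν)
    (h_comp : ∀ ν μ τ, ν ≤ μ → μ ≤ τ → h ν μ * h μ τ - h ν τ ∈ I τ)
    (h_mem : ∀ ν μ, ν ≤ μ → ∀ x, h ν μ * x ∈ I μ ↔ x ∈ I ν) :
    ∃ (U : Type u) (_ : AddCommGroup U) (_ : Module R U) (a : Omega1 → U),
      (∀ x, ∃ ν, ∃ s : R, x = s • a ν) ∧ (∀ ν (s : R), s • a ν = 0 ↔ s ∈ I ν) ∧
      ∀ ν μ, ν ≤ μ → a ν = h ν μ • a μ := by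
  classical
  let f : ∀ ν μ, ν ≤ μ → (R ⧸ I ν) →ₗ[R] (R ⧸ I μ) := fun ν μ hνμ =>
    Submodule.mapQ (I ν) (I μ) (LinearMap.mulLeft R (h ν μ)) fun x hx => (h_mem ν μ hνμ x).2 hx
  have hf : ∀ ν μ hνμ x, f ν μ hνμ (Submodule.Quotient.mk x) = Submodule.Quotient.mk (h ν μ * x) :=
    fun ν μ hνμ x => rfl
  have hdir : DirectedSystem (fun ν => R ⧸ I ν) (fun ν μ hνμ => f ν μ hνμ) := by
    refine ⟨fun ν x => ?_, fun τ μ ν hνμ hμτ x => ?_⟩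
    · obtain ⟨x, rfl⟩ := Submodule.Quotient.mk_surjective _ x
      rw [hf _ _ le_rfl, Submodule.Quotient.eq]
      have := (I ν).mul_mem_right x (h_self ν)
      rwa [sub_mul, one_mul] at this
    · obtain ⟨x, rfl⟩ := Submodule.Quotient.mk_surjective _ x
      rw [hf _ _ hνμ, hf _ _ hμτ, hf _ _ (hνμ.trans hμτ), Submodule.Quotient.eq]
      have := (I _).mul_mem_right x (h_comp _ _ _ hνμ hμτ)
      convert this using 1
      ring
  let a : Omega1 → Module.DirectLimit (fun ν => R ⧸ I ν) f := fun ν =>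
    Module.DirectLimit.of R Omega1 (fun ν => R ⧸ I ν) f ν (Submodule.Quotient.mk 1)
  have ha : ∀ ν (s : R), s • a ν =
      Module.DirectLimit.of R Omega1 (fun ν => R ⧸ I ν) f ν (Submodule.Quotient.mk s) := by
    intro ν s
    rw [← map_smul, ← Submodule.Quotient.mk_smul, _root_.smul_eq_mul, mul_one]
  refine ⟨Module.DirectLimit (fun ν => R ⧸ I ν) f, inferInstance, inferInstance, a,
    fun x => ?_, fun ν s => ⟨fun hs => ?_, fun hs => ?_⟩, fun ν μ hνμ => ?_⟩
  · obtain ⟨ν, y, rfl⟩ := Module.DirectLimit.exists_of x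
    obtain ⟨s, rfl⟩ := Submodule.Quotient.mk_surjective _ y
    exact ⟨ν, s, (ha ν s).symm⟩
  · rw [ha] at hs
    obtain ⟨μ, hνμ, h0⟩ := Module.DirectLimit.of.zero_exact hs
    rw [hf _ _ hνμ, Submodule.Quotient.mk_eq_zero] at h0
    exact (h_mem ν μ hνμ s).1 h0
  · rw [ha, (Submodule.Quotient.mk_eq_zero _).2 hs, map_zero]
  · rw [ha, ← mul_one (h ν μ), ← hf ν μ hνμ 1]
    exact (Module.DirectLimit.of_f (hij := hνμ)).symm

end Limit

/-! ### Twisted limits over a valuation domain -/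

section Twisted

variable {R : Type*} [CommRing R] {Q : Type*} [Field Q] [Algebra R Q]

theorem mem_scaledIdeal {A : Submodule R Q} {q : Q} (hq : q ≠ 0) {x : R} :
    x ∈ scaledIdeal A q ↔ x • q⁻¹ ∈ A := by
  rw [scaledIdeal, Submodule.mem_comap, Submodule.mem_map]
  simp only [Algebra.linearMap_apply, LinearMap.mulLeft_apply, Algebra.smul_def]
  constructor
  · rintro ⟨y, hy, h⟩
    rw [← h]
    convert hy using 1
    field_simp
  · exact fun h => ⟨_, h, by field_simp⟩

theorem IsPresentation.dvd_of_le {J : Submodule R Q} {r : Omega1 → Q} (hr : IsPresentation J r)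
    {ν μ : Omega1} (h : ν ≤ μ) : ∃ c : R, r μ = c • r ν := by
  rcases h.eq_or_lt with rfl | h
  · exact ⟨1, (one_smul R _).symm⟩
  · exact hr.dvd ν μ h

theorem IsPresentation.mem {J : Submodule R Q} {r : Omega1 → Q} (hr : IsPresentation J r) {x : Q} :
    x ∈ J ↔ ∃ ν, ∃ s : R, s • (r ν)⁻¹ = x := by
  rw [← SetLike.mem_coe, hr.union]
  simp [Submodule.mem_span_singleton]

theorem IsPresentation.antitone {J : Submodule R Q} {r : Omega1 → Q} (hr : IsPresentation J r)
    (A : Submodule R Q) : Antitone fun ν => scaledIdeal A (r ν) := by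
  intro ν μ h x hx
  obtain ⟨c, hc⟩ := hr.dvd_of_le h
  have h1 := hr.ne_zero ν
  have h2 := hr.ne_zero μ
  rw [mem_scaledIdeal h1]
  rw [mem_scaledIdeal h2] at hx
  have h3 := A.smul_mem c hx
  convert h3 using 1
  rw [hc] at h2 ⊢
  simp only [Algebra.smul_def] at h2 ⊢
  have h4 := left_ne_zero_of_mul h2
  field_simp

/-- The module `U` is the union of the cyclic modules generated by `a ν`, which are isomorphic to
`(r ν)⁻¹ R / A`, and the inclusions are twisted by the units `e μ ν`. -/
structure IsTwistedLimit (r : Omega1 → Q) (A : Submodule R Q) (e : Omega1 → Omega1 → Rˣ)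
    {U : Type*} [AddCommGroup U] [Module R U] (a : Omega1 → U) : Prop where
  gen : ∀ x, ∃ ν, ∃ s : R, x = s • a ν
  ann : ∀ ν (s : R), s • a ν = 0 ↔ s • (r ν)⁻¹ ∈ A
  map : ∀ ν μ, ν ≤ μ → ∃ c : R, r μ = c • r ν ∧ a ν = (c * e μ ν) • a μ

theorem exists_isTwistedLimit {R : Type u} [CommRing R] [Algebra R Q] [FaithfulSMul R Q]
    {J : Submodule R Q} {r : Omega1 → Q} (hr : IsPresentation J r) (A : Submodule R Q)
    {e : Omega1 → Omega1 → Rˣ}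
    (he : ∀ δ, CoherentBelow (fun ν => unitsOneMod (scaledIdeal A (r ν))) e δ) :
    ∃ (U : Type u) (_ : AddCommGroup U) (_ : Module R U) (a : Omega1 → U),
      IsTwistedLimit r A e a := by
  have hc : ∀ ν μ, ∃ c : R, ν ≤ μ → r μ = c • r ν := fun ν μ => by
    by_cases h : ν ≤ μ
    · obtain ⟨c, hc⟩ := hr.dvd_of_le h
      exact ⟨c, fun _ => hc⟩
    · exact ⟨0, fun h' => absurd h' h⟩
  choose c hc using hc
  have hc' : ∀ ν μ, ν ≤ μ → algebraMap R Q (c ν μ) = r μ / r ν := fun ν μ h => by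
    rw [eq_div_iff (hr.ne_zero ν), ← Algebra.smul_def, hc ν μ h]
  have hinj := FaithfulSMul.algebraMap_injective R Q
  have hcomp : ∀ ν μ τ, ν ≤ μ → μ ≤ τ → c ν μ * c μ τ = c ν τ := fun ν μ τ h h' => by
    apply hinj
    have := hr.ne_zero μ
    have := hr.ne_zero ν
    rw [map_mul, hc' _ _ h, hc' _ _ h', hc' _ _ (h.trans h')]
    field_simp
  have hmem : ∀ ν μ, ν ≤ μ → ∀ x, c ν μ * x ∈ scaledIdeal A (r μ) ↔ x ∈ scaledIdeal A (r ν) := by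
    intro ν μ h x
    have h1 := hr.ne_zero μ
    have h2 := hr.ne_zero ν
    rw [mem_scaledIdeal h1, mem_scaledIdeal h2]
    have : (c ν μ * x) • (r μ)⁻¹ = x • (r ν)⁻¹ := by
      simp only [Algebra.smul_def, map_mul, hc' _ _ h]
      field_simp
    rw [this]
  have hself : ∀ ν, c ν ν = 1 := fun ν => hinj (by
    rw [hc' ν ν le_rfl, div_self (hr.ne_zero ν), map_one])
  have hone : ∀ ν, e ν ν = 1 := fun ν => by
    obtain ⟨δ, hδ⟩ := exists_gt_omega1 ν
    exact (he δ).refl ν hδ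
  obtain ⟨U, i1, i2, a, h1, h2, h3⟩ := exists_limit (I := fun ν => scaledIdeal A (r ν))
    (h := fun ν μ => c ν μ * e μ ν) (fun ν => by simp [hself, hone]) (fun ν μ τ h h' => by
      obtain ⟨δ, hδ⟩ := exists_gt_omega1 τ
      have h1 := unitsOneMod_eq_iff.1 ((he δ).comp ν μ τ h h' hδ)
      -- Multiplying by `r τ / r ν` turns coherence modulo `I ν` into the congruence modulo `I τ`
      -- that the transition maps need.
      rw [← hmem ν τ (h.trans h'), ← hcomp ν μ τ h h'] at h1
      rw [← hcomp ν μ τ h h']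
      convert h1 using 1
      push_cast
      ring) (fun ν μ h x => by
      rw [mul_assoc, hmem _ _ h]
      exact Ideal.unit_mul_mem_iff_mem _ (e μ ν).isUnit)
  exact ⟨U, i1, i2, a, h1, fun ν s => (h2 ν s).trans (mem_scaledIdeal (hr.ne_zero ν)),
    fun ν μ h => ⟨c ν μ, hc ν μ h, h3 ν μ h⟩⟩

namespace IsTwistedLimit

variable {J A : Submodule R Q} {r : Omega1 → Q} {e : Omega1 → Omega1 → Rˣ}
  {U : Type*} [AddCommGroup U] [Module R U] {a : Omega1 → U}

theorem gen_ge (h : IsTwistedLimit r A e a) (κ : Omega1) (x : U) :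
    ∃ ν, κ ≤ ν ∧ ∃ s : R, x = s • a ν := by
  obtain ⟨ν, s, rfl⟩ := h.gen x
  obtain ⟨c, -, hc⟩ := h.map ν (max κ ν) (le_max_right _ _)
  exact ⟨max κ ν, le_max_left _ _, s * (c * e (max κ ν) ν), by rw [mul_smul, ← hc]⟩

variable [IsDomain R] [ValuationRing R]

/-- Any two elements lie in one cyclic submodule, where divisibility in `R` compares them. -/
theorem isUniserial (h : IsTwistedLimit r A e a) : IsUniserial R U := by
  intro N P
  by_contra! H
  obtain ⟨x, hxN, hxP⟩ := SetLike.not_le_iff_exists.1 H.1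
  obtain ⟨y, hyP, hyN⟩ := SetLike.not_le_iff_exists.1 H.2
  obtain ⟨ν, s, rfl⟩ := h.gen x
  obtain ⟨μ, hνμ, t, rfl⟩ := h.gen_ge ν y
  obtain ⟨c, -, hc⟩ := h.map ν μ hνμ
  rw [hc, ← mul_smul] at hxN hxP
  rcases ValuationRing.dvd_total (s * (c * e μ ν)) t with ⟨k, hk⟩ | ⟨k, hk⟩
  · rw [hk, mul_comm, mul_smul] at hyN
    exact hyN (N.smul_mem k hxN)
  · rw [hk, mul_comm, mul_smul] at hxP
    exact hxP (P.smul_mem k hyP)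

/-- Multiplication by a non-zero element of `Q`. -/
noncomputable def mulEquiv (R : Type*) [CommRing R] {Q : Type*} [Field Q] [Algebra R Q] {q : Q}
    (hq : q ≠ 0) : Q ≃ₗ[R] Q :=
  LinearEquiv.ofBijective (LinearMap.mulLeft R q) (mulLeft_bijective₀ q hq)

theorem divSubmodule_eq (hr : IsPresentation J r) (h : IsTwistedLimit r A e a) {κ : Omega1}
    (hκ : a κ ≠ 0) : divSubmodule R Q (a κ) = J.map (mulEquiv R (hr.ne_zero κ)).toLinearMap := by
  have hq := hr.ne_zero κ
  refine le_antisymm (iSup_le ?_) ?_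
  · rintro ⟨d, y, hy⟩
    rw [Submodule.span_singleton_le_iff_mem]
    obtain ⟨μ, hμ, s, rfl⟩ := h.gen_ge κ y
    obtain ⟨c, hc, hac⟩ := h.map κ μ hμ
    have hμ0 := hr.ne_zero μ
    have hdvd : d ∣ c := by
      rcases ValuationRing.dvd_total d c with h1 | ⟨k, rfl⟩
      · exact h1
      · by_cases hk : IsUnit k
        · exact (hk.mul_right_dvd).2 dvd_rfl
        -- A proper multiple `d = c * k` cannot divide `a κ`: the relation becomes `c * (e μ κ - k *
        -- s)` annihilating `a μ`, and the second factor is a unit, which forces `a κ = 0`.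
        · have h2 : IsUnit ((e μ κ : R) - k * s) := by
            by_contra h2
            refine (IsLocalRing.mem_maximalIdeal (e μ κ : R)).1 ?_ (e μ κ).isUnit
            rw [← sub_add_cancel (e μ κ : R) (k * s)]
            exact add_mem ((IsLocalRing.mem_maximalIdeal _).2 h2)
              (Ideal.mul_mem_right _ _ ((IsLocalRing.mem_maximalIdeal _).2 hk))
          obtain ⟨v, hv⟩ := h2
          have h3 : (v : R) • c • a μ = 0 := by
            rw [hac, ← mul_smul, ← sub_eq_zero, ← sub_smul] at hy
            rw [hv, ← mul_smul]
            rw [← neg_eq_zero, ← neg_smul] at hy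
            convert hy using 2
            ring
          have h4 : c • a μ = 0 := by
            have := congrArg (fun z => (↑v⁻¹ : R) • z) h3
            simpa [← mul_smul] using this
          refine absurd ?_ hκ
          rw [hac, mul_comm, mul_smul, h4, smul_zero]
    obtain ⟨k, rfl⟩ := hdvd
    refine ⟨k • (r μ)⁻¹, hr.mem.2 ⟨μ, k, rfl⟩, ?_⟩
    change r κ * k • (r μ)⁻¹ = (algebraMap R Q d)⁻¹
    rw [Algebra.smul_def, map_mul] at hc
    rw [hc] at hμ0 ⊢
    have h5 := left_ne_zero_of_mul hμ0
    have h6 := left_ne_zero_of_mul h5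
    have h7 := right_ne_zero_of_mul h5
    rw [Algebra.smul_def]
    field_simp
  · rintro _ ⟨y, hy, rfl⟩
    obtain ⟨ν, t, rfl⟩ := hr.mem.1 hy
    obtain ⟨c₁, hc₁⟩ := hr.dvd_of_le (le_max_right κ ν)
    obtain ⟨c, hc, hac⟩ := h.map κ _ (le_max_left κ ν)
    have hμ0 := hr.ne_zero (max κ ν)
    have hν0 := hr.ne_zero ν
    refine Submodule.mem_iSup_of_mem ⟨c, (e (max κ ν) κ : R) • a (max κ ν), by
      rw [← mul_smul, ← hac]⟩ (Submodule.mem_span_singleton.2 ⟨t * c₁, ?_⟩)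
    change (t * c₁) • (algebraMap R Q c)⁻¹ = r κ * t • (r ν)⁻¹
    rw [Algebra.smul_def] at hc hc₁
    have h1 : algebraMap R Q c = r (max κ ν) / r κ := by rw [hc]; field_simp
    have h2 : algebraMap R Q c₁ = r (max κ ν) / r ν := by rw [hc₁]; field_simp
    rw [Algebra.smul_def, Algebra.smul_def, map_mul, h1, h2]
    field_simp

variable [IsFractionRing R Q]

theorem annSubmodule_eq (hr : IsPresentation J r) (h : IsTwistedLimit r A e a) {κ : Omega1}
    (hκ : a κ ≠ 0) : annSubmodule R Q (a κ) = A.map (mulEquiv R (hr.ne_zero κ)).toLinearMap := by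
  have hq := hr.ne_zero κ
  have h1 : (r κ)⁻¹ ∉ A := fun h1 => hκ (by simpa using (h.ann κ 1).2 (by simpa using h1))
  ext x
  rw [annSubmodule, Submodule.mem_map, Submodule.mem_map]
  constructor
  · rintro ⟨s, hs, rfl⟩
    refine ⟨s • (r κ)⁻¹, (h.ann κ s).1 ((Ideal.mem_torsionOf_iff _ _).1 hs), ?_⟩
    change r κ * s • (r κ)⁻¹ = algebraMap R Q s
    rw [Algebra.smul_def]
    field_simp
  · rintro ⟨y, hy, rfl⟩
    change ∃ s, s ∈ _ ∧ algebraMap R Q s = r κ * y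
    rcases ValuationRing.isInteger_or_isInteger R (r κ * y) with ⟨s, hs⟩ | ⟨s, hs⟩
    · refine ⟨s, (Ideal.mem_torsionOf_iff _ _).2 ((h.ann κ s).2 ?_), hs⟩
      convert hy using 1
      rw [Algebra.smul_def, hs]
      field_simp
    · rcases eq_or_ne y 0 with rfl | hy0
      · exact ⟨0, zero_mem _, by simp⟩
      -- If `r κ * y` had only its inverse `s` in `R`, then `s • y = (r κ)⁻¹` would lie in `A`,
      -- making `a κ` zero.
      · refine absurd (A.smul_mem s hy) ?_
        convert h1 using 2
        rw [Algebra.smul_def, hs]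
        field_simp

theorem hasType (hr : IsPresentation J r) (h : IsTwistedLimit r A e a) {κ : Omega1}
    (hκ : a κ ≠ 0) : HasType U J A := by
  refine ⟨a κ, hκ, ?_⟩
  rw [annSubmodule_eq hr h hκ, divSubmodule_eq hr h hκ]
  let E := mulEquiv R (hr.ne_zero κ)
  refine ⟨Submodule.Quotient.equiv _ _ (E.submoduleMap J) ?_⟩
  ext ⟨x, hx⟩
  simp only [Submodule.mem_map, Submodule.submoduleOf, Submodule.mem_comap]
  constructor
  · rintro ⟨y, hy, h1⟩
    exact ⟨y, hy, congrArg Subtype.val h1⟩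
  · rintro ⟨y, hy, h1⟩
    obtain ⟨z, hz, h2⟩ := hx
    have : y = z := E.injective (h1.trans h2.symm)
    exact ⟨⟨y, this ▸ hz⟩, hy, Subtype.ext h1⟩

/-- An isomorphism from a twisted limit to a standard module trivializes the system of units. -/
theorem exists_units_of_isStandard (hr : IsPresentation J r) (h : IsTwistedLimit r A e a)
    {κ : Omega1} (hκ : a κ ≠ 0) (hst : IsStandard R Q U) :
    ∃ u : Omega1 → Rˣ, ∀ ν μ, κ ≤ ν → ν ≤ μ →
      ((e μ ν * u μ : Rˣ) : R) - u ν ∈ scaledIdeal A (r ν) := by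
  obtain ⟨J', A', -, ⟨φ⟩⟩ := hst
  choose x hx using fun ν => Submodule.Quotient.mk_surjective _ (φ (a ν))
  have hmk : ∀ (ν μ : Omega1) (s t : R), s • a ν = t • a μ ↔ s • (x ν : Q) - t • (x μ : Q) ∈ A' := by
    intro ν μ s t
    rw [← φ.injective.eq_iff, map_smul, map_smul, ← hx, ← hx, ← Submodule.Quotient.mk_smul,
      ← Submodule.Quotient.mk_smul, Submodule.Quotient.eq]
    rfl
  have hzero : ∀ (ν : Omega1) (s : R), s • a ν = 0 ↔ s • (x ν : Q) ∈ A' := by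
    intro ν s
    have := hmk ν ν s 0
    simpa using this
  have hxκ : (x κ : Q) ∉ A' := fun h1 => hκ (by simpa using (hzero κ 1).2 (by simpa using h1))
  have hxκ0 : (x κ : Q) ≠ 0 := fun h1 => hxκ (h1 ▸ zero_mem A')
  have hunit : ∀ v : R, v • (x κ : Q) ∈ A' → ¬ IsUnit v := by
    rintro _ hv ⟨v, rfl⟩
    apply hxκ
    have := A'.smul_mem (↑v⁻¹ : R) hv
    simpa [← mul_smul] using this
  have hsub : ∀ (v : Rˣ) (k : R), ((v : R) - k) • (x κ : Q) ∈ A' → IsUnit k := by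
    intro v k hk
    by_contra hk'
    refine (IsLocalRing.mem_maximalIdeal (v : R)).1 ?_ v.isUnit
    rw [← sub_add_cancel (v : R) k]
    exact add_mem ((IsLocalRing.mem_maximalIdeal _).2 (hunit _ hk))
      ((IsLocalRing.mem_maximalIdeal _).2 hk')
  -- In the untwisted module the lift `x ν` can be taken as `(r ν)⁻¹`, so `x ν * r ν` measures the
  -- twist. The relation between `a κ` and `a ν` makes its ratio to `x κ * r κ` a unit.
  have key : ∀ ν, ∃ v : Rˣ, κ ≤ ν → (x ν : Q) * r ν = algebraMap R Q v * (x κ * r κ) := by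
    intro ν
    by_cases hν : κ ≤ ν
    swap
    · exact ⟨1, fun h => absurd h hν⟩
    obtain ⟨c, hc, hac⟩ := h.map κ ν hν
    have h1 := (hmk κ ν 1 (c * e ν κ)).1 (by rw [one_smul, hac])
    have hκ0 := hr.ne_zero κ
    have hν0 := hr.ne_zero ν
    set z : Q := (x ν * r ν) / (x κ * r κ) with hz
    have hcz : algebraMap R Q c * x ν = z * x κ := by
      rw [Algebra.smul_def] at hc
      rw [hz, hc]
      field_simp
    rw [one_smul, Algebra.smul_def, map_mul, mul_right_comm, hcz] at h1
    suffices ∃ v : Rˣ, algebraMap R Q v = z by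
      obtain ⟨v, hv⟩ := this
      refine ⟨v, fun _ => ?_⟩
      rw [hv, hz]
      field_simp
    rcases ValuationRing.isInteger_or_isInteger R z with ⟨k, hk⟩ | ⟨k, hk⟩
    · have h2 : IsUnit (k * e ν κ) := hsub 1 _ (by
        convert h1 using 1
        rw [Algebra.smul_def, map_sub, map_mul, hk]
        simp only [Units.val_one, map_one]
        ring)
      obtain ⟨v, rfl⟩ := isUnit_of_mul_isUnit_left h2
      exact ⟨v, hk⟩
    · have hz0 : z ≠ 0 := by
        rintro h0
        rw [h0] at h1
        exact hxκ (by simpa using h1)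
      have h2 : IsUnit k := hsub (e ν κ) k (by
        have := A'.smul_mem (-k) h1
        convert this using 1
        rw [Algebra.smul_def, Algebra.smul_def, map_sub, map_neg, hk]
        field_simp
        ring)
      obtain ⟨v, rfl⟩ := h2
      refine ⟨v⁻¹, ?_⟩
      rw [← inv_inv z, ← hk, ← mul_eq_one_iff_eq_inv₀ (by simp), ← map_mul]
      simp
  choose u hu using key
  refine ⟨u, fun ν μ hν hνμ => ?_⟩
  obtain ⟨c, hc, hac⟩ := h.map ν μ hνμ
  have hκ0 := hr.ne_zero κ
  have hν0 := hr.ne_zero ν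
  have hμ0 := hr.ne_zero μ
  -- The annihilator of `a ν` is read both in `A` and in `A'`. On the side of `A'`, `u ν * c * x μ =
  -- u μ * x ν` turns the goal into a multiple of the relation between `a ν` and `a μ`.
  rw [mem_scaledIdeal hν0, ← h.ann, hzero]
  have h1 := A'.smul_mem (-(u ν : R)) ((hmk ν μ 1 (c * e μ ν)).1 (by rw [one_smul, hac]))
  convert h1 using 1
  have h2 : (x ν : Q) = algebraMap R Q (u ν) * (x κ * r κ) / r ν := by
    rw [← hu ν hν]; field_simp
  have h3 : (x μ : Q) = algebraMap R Q (u μ) * (x κ * r κ) / r μ := by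
    rw [← hu μ (hν.trans hνμ)]; field_simp
  rw [Algebra.smul_def] at hc
  rw [h2, h3]
  simp only [Algebra.smul_def, map_sub, map_neg, map_mul, map_one, Units.val_mul]
  have h4 : algebraMap R Q c = r μ / r ν := by rw [hc]; field_simp
  rw [h4]
  field_simp
  ring

end IsTwistedLimit

end Twisted

/-! ### The main results -/

/-- Each `(r ν)⁻¹` with `ν < δ` lies in `J_δ`, so `(A : J_δ)` is contained in every `I ν` and
incompleteness can be tested on families in `R`. -/
theorem exists_gap_of_mem_gammaSet {R : Type*} [CommRing R] [IsLocalRing R] {Q : Type*} [Field Q]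
    [Algebra R Q] {J A : Submodule R Q} {r : Omega1 → Q} (hr : IsPresentation J r) {δ : Omega1}
    (hδ : δ ∈ gammaSet A r) : ∃ t, IsGapBelow (fun ν => unitsOneMod (scaledIdeal A (r ν))) δ t := by
  classical
  obtain ⟨t, ht, hlim⟩ := exists_cauchy_of_not_isLinearlyComplete
    (fun ν μ h => hr.antitone A (Subtype.coe_le_coe.2 h)) (fun ν x hx => by
      rw [mem_scaledIdeal (hr.ne_zero _)]
      exact Submodule.mem_colon.1 hx _ (Submodule.mem_iSup_of_mem ν
        (Submodule.mem_span_singleton_self _))) hδ.2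
  refine exists_gap_units (hr.antitone A) (t := fun ν => if h : ν < δ then t ⟨ν, h⟩ else 0)
    (fun ν μ h h' => ?_) fun ⟨x, hx⟩ => hlim ⟨x, fun ν => ?_⟩
  · simp only [h', h.trans_lt h', dif_pos]
    exact ht ⟨ν, h.trans_lt h'⟩ ⟨μ, h'⟩ h
  · have := hx ν ν.2
    rwa [dif_pos (Set.mem_Iio.1 ν.2)] at this

theorem exists_nonstandard {R : Type u} [CommRing R] [IsDomain R] [ValuationRing R]
    {Q : Type v} [Field Q] [Algebra R Q] [IsFractionRing R Q]
    (hR : Cardinal.mk R = Cardinal.aleph 1) (J A : Submodule R Q) {S : Set Omega1}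
    (hS : Gamma J A = ClubClass.mk S) (hW : WeakDiamond S) :
    ∃ (U : Type u) (_ : AddCommGroup U) (_ : Module R U),
      IsUniserial R U ∧ HasType U J A ∧ ¬ IsStandard R Q U := by
  by_cases hex : ∃ r : Omega1 → Q, IsPresentation J r
  swap
  · rw [Gamma, dif_neg hex] at hS
    -- Without a presentation `S` is equivalent to `∅`, where weak diamond fails.
    exact absurd (hW.congr hS.symm).nonempty Set.not_nonempty_empty
  obtain ⟨r, hr⟩ := hex
  rw [Gamma_eq hr] at hS
  have hW' := hW.congr hS.symm
  let N : Omega1 → Subgroup Rˣ := fun ν => unitsOneMod (scaledIdeal A (r ν))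
  have hN : Antitone N := fun ν μ h => unitsOneMod_mono (hr.antitone A h)
  have hgap : ∀ δ ∈ gammaSet A r, ∃ t, IsGapBelow N δ t :=
    fun δ hδ => exists_gap_of_mem_gammaSet hr hδ
  obtain ⟨e, he, hnt⟩ := hW'.exists_coherent
    ((Cardinal.mk_le_of_injective Units.val_injective).trans hR.le) hN hgap
  obtain ⟨U, i1, i2, a, ha⟩ := exists_isTwistedLimit hr A he
  obtain ⟨κ, hκ⟩ : ∃ κ, a κ ≠ 0 := by
    by_contra! H
    -- If all generators vanished, every `I ν` would be `R` and no gap could exist.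
    obtain ⟨δ, hδ⟩ := hW'.nonempty
    obtain ⟨t, -, ht⟩ := hgap δ hδ
    refine ht ⟨1, fun ν _ => unitsOneMod_eq_iff.2 ?_⟩
    rw [mem_scaledIdeal (hr.ne_zero ν), ← ha.ann, H, smul_zero]
  refine ⟨U, i1, i2, ha.isUniserial, ha.hasType hr hκ, fun hst => ?_⟩
  obtain ⟨u, hu⟩ := ha.exists_units_of_isStandard hr hκ hst
  exact hnt (exists_compat_of_tail hN he κ fun ν μ h h' => unitsOneMod_eq_iff.2 (hu ν μ h h'))

end Uniserial

theorem proposition3 {R : Type u} [CommRing R] [IsDomain R] [ValuationRing R]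
    {Q : Type v} [Field Q] [Algebra R Q] [IsFractionRing R Q]
    (hQ : ¬ Function.Surjective (algebraMap R Q))
    (hR : Cardinal.mk R = Cardinal.aleph 1)
    (J A : Submodule R Q) (hAJ : A ≤ J) :
    (∀ S : Set Uniserial.Omega1, Uniserial.Gamma J A = Uniserial.ClubClass.mk S →
      Uniserial.Diamond S →
        ∃ (U : Type u) (_ : AddCommGroup U) (_ : Module R U),
          Uniserial.IsUniserial R U ∧ Uniserial.HasType U J A ∧ ¬ Uniserial.IsStandard R Q U) ∧
    (∀ S : Set Uniserial.Omega1, Uniserial.Gamma J A = Uniserial.ClubClass.mk S →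
      Uniserial.WeakDiamond S →
        ∃ (U : Type u) (_ : AddCommGroup U) (_ : Module R U),
          Uniserial.IsUniserial R U ∧ Uniserial.HasType U J A ∧ ¬ Uniserial.IsStandard R Q U) ∧
    (Uniserial.Gamma J A = 1 → Cardinal.continuum.{0} = Cardinal.aleph 1 →
        ∃ (U : Type u) (_ : AddCommGroup U) (_ : Module R U),
          Uniserial.IsUniserial R U ∧ Uniserial.HasType U J A ∧ ¬ Uniserial.IsStandard R Q U) := by
  refine ⟨fun S hS hD => Uniserial.exists_nonstandard hR J A hS hD.weakDiamond,
    fun S hS hW => Uniserial.exists_nonstandard hR J A hS hW, fun h1 hCH => ?_⟩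
  refine Uniserial.exists_nonstandard hR J A h1 (Uniserial.weakDiamond_univ ?_)
  rw [hCH]
  exact Cardinal.cantor _
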